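/- Let $F$ be an infinite field with $\operatorname{char} F\neq 2$ and let $d\ge 0$ be an integer. Consider words in the letters $x_1,\dots,x_d,x_1^T,\dots,x_d^T$ with the involution $(x_k^T)^T=x_k$, $(a_1\cdots a_r)^T=a_r^T\cdots a_1^T$. Write $a\sim b$ if $a$ is a cyclic rotation of $b$ or of $b^T$. A nonempty word is called primitive if it is not a power of a shorter word. Let $N_\sigma$ be the commutative polynomial algebra over $F$ freely generated by the symbols $\sigma_t(a)$, where $t>0$ is an integer and $a$ ranges over the $\sim$-classes of primitive words. For $n>0$ let $G$ be $O(n)=\{A\in F^{n\times n} : AA^T=E\}$, or, when $n$ is even, $Sp(n)=\{A\in F^{n\times n} : AA^*=E\}$, where $A^*=-JA^TJ$ and $J=\begin{pmatrix}0&E\\-E&0\end{pmatrix}$. Let $R=F[x_{ij}(k) : 1\le i,j\le n,\ 1\le k\le d]$, let $X_k=(x_{ij}(k))$ be the generic $n\times n$ matrices, and let $R^G$ be the algebra of invariants of the action of $G$ on $R$ in which $g\cdot x_{ij}(k)$ is the $(i,j)$ entry of $g^{-1}X_kg$. For an $n\times n$ matrix $X$ define $\sigma_t(X)$ by $\det(X+\lambda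 E)=\sum_{t=0}^n\lambda^{n-t}\sigma_t(X)$. For a word $a$ let $X_a$ be the product of matrices obtained from $a$ by replacing $x_k$ with $X_k$, and $x_k^T$ with $X_k^T$ if $G=O(n)$ and with $X_k^*$ if $G=Sp(n)$. Let $\Psi_n:N_\sigma\to R^G$ be the (well defined) homomorphism of $F$-algebras with $\Psi_n(\sigma_t(a))=\sigma_t(X_a)$ if $t\le n$ and $\Psi_n(\sigma_t(a))=0$ if $t>n$, and let $K_n=\ker\Psi_n$. Let $K_\infty=\bigcap_n K_n$ be the ideal of free relations, where $n$ runs over all positive integers in the orthogonal case and over all even positive integers in the symplectic case. **Theorem.** In the orthogonal case as well as in the symplectic case, $K_\infty=0$; that is, there are no nonzero free relations. -/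

import Mathlib

noncomputable section

namespace FreeRel

/-! ### Words in the letters `x_k`, `x_kᵀ` -/

/-- The letters: `(k, false)` is `x_k` and `(k, true)` is `x_kᵀ`. -/
abbrev Letter (d : ℕ) : Type := Fin d × Bool

/-- Words in the letters; the empty word `1` is excluded wherever primitive words are used. -/
abbrev Word (d : ℕ) : Type := FreeMonoid (Letter d)

/-- The involution `x_k ↔ x_kᵀ` on letters. -/
def Letter.tr {d : ℕ} (b : Letter d) : Letter d := (b.1, !b.2)

/-- The involution `(a₁ ⋯ a_r)ᵀ = a_rᵀ ⋯ a₁ᵀ` on words. -/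
def Word.tr {d : ℕ} (a : Word d) : Word d :=
  FreeMonoid.ofList ((FreeMonoid.toList a).map Letter.tr).reverse

/-- Two words are cyclically equivalent if one is a cyclic rotation of the other. -/
def CycEquiv {d : ℕ} (a b : Word d) : Prop :=
  (FreeMonoid.toList a).IsRotated (FreeMonoid.toList b)

/-- `a ∼ b`: the word `a` is cyclically equivalent to `b` or to `bᵀ`. -/
def WordEquiv {d : ℕ} (a b : Word d) : Prop :=
  CycEquiv a b ∨ CycEquiv a b.tr

/-- A nonempty word is primitive if it is not a power of a shorter word. -/
def IsPrimitiveWord {d : ℕ} (a : Word d) : Prop :=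
  a ≠ 1 ∧ ¬ ∃ (b : Word d) (k : ℕ), b.length < a.length ∧ a = b ^ k

/-- The set of primitive words. -/
abbrev PrimWord (d : ℕ) : Type := {a : Word d // IsPrimitiveWord a}

lemma Word.tr_tr {d : ℕ} (a : Word d) : a.tr.tr = a := by
  have : (Letter.tr ∘ Letter.tr : Letter d → Letter d) = id := by
    funext b; simp [Letter.tr]
  simp [Word.tr, List.map_reverse, this]

lemma CycEquiv.tr {d : ℕ} {a b : Word d} (h : CycEquiv a b) : CycEquiv a.tr b.tr := by
  unfold CycEquiv Word.tr at *
  simpa using (h.map Letter.tr).reverse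

lemma wordEquiv_equivalence (d : ℕ) : Equivalence (WordEquiv (d := d)) where
  refl a := Or.inl (List.IsRotated.refl _)
  symm := by
    rintro a b (h | h)
    · exact Or.inl (List.IsRotated.symm h)
    · refine Or.inr ?_
      have := h.tr
      rw [Word.tr_tr] at this
      exact List.IsRotated.symm this
  trans := by
    rintro a b c (h | h) (h' | h')
    · exact Or.inl (List.IsRotated.trans h h')
    · exact Or.inr (List.IsRotated.trans h h')
    · exact Or.inr (List.IsRotated.trans h h'.tr)
    · have := h'.tr
      rw [Word.tr_tr] at this
      exact Or.inl (List.IsRotated.trans h this)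

/-- The equivalence `∼` on primitive words. -/
def primSetoid (d : ℕ) : Setoid (PrimWord d) where
  r a b := WordEquiv a.1 b.1
  iseqv := (wordEquiv_equivalence d).comap Subtype.val

/-- The `∼`-classes of primitive words. -/
abbrev PrimClass (d : ℕ) : Type := Quotient (primSetoid d)

/-- The commutative polynomial ring freely generated by the symbols `σ_t(a)`, where `t > 0` and
`a` ranges over the `∼`-classes of primitive words; `σ_t(a)` is the variable `(t, [a])`. -/
abbrev NSigma (F : Type*) [Field F] (d : ℕ) : Type _ := MvPolynomial (ℕ+ × PrimClass d) F

/-! ### Matrices -/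

section Matrices

variable {ι : Type*} [Fintype ι] [DecidableEq ι] {A : Type*} [CommRing A]

/-- `σ_t(X)` for an `n × n` matrix `X` and `0 ≤ t ≤ n`, i.e. the coefficient of `λ ^ (n - t)` in
`det (X + λ E)`. -/
def sigma (t : ℕ) (X : Matrix ι ι A) : A :=
  ((X.map Polynomial.C + (Polynomial.X : Polynomial A) • (1 : Matrix ι ι (Polynomial A))).det).coeff
    (Fintype.card ι - t)

/-- The symplectic transpose `A* = -J Aᵀ J` of a `2m × 2m` matrix. Here `J` is Mathlib's
`Matrix.J`; replacing `J` by `-J` does not change `A*`. -/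
def sympTranspose {m : ℕ} (X : Matrix (Fin m ⊕ Fin m) (Fin m ⊕ Fin m) A) :
    Matrix (Fin m ⊕ Fin m) (Fin m ⊕ Fin m) A :=
  -(Matrix.J (Fin m) A * X.transpose * Matrix.J (Fin m) A)

/-- `X_a = X_{a₁} ⋯ X_{a_r}`, where `X_b = X_k` if `b = x_k` and `X_b = δ(X_k)` if `b = x_kᵀ`.
Here `δ` is the transposition or the symplectic transposition. -/
def wordEval {d : ℕ} (δ : Matrix ι ι A → Matrix ι ι A) (X : Fin d → Matrix ι ι A) :
    Word d →* Matrix ι ι A :=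
  FreeMonoid.lift fun b : Letter d => if b.2 then δ (X b.1) else X b.1

lemma sigma_eq_charpoly (t : ℕ) (X : Matrix ι ι A) :
    sigma t X = (-X).charpoly.coeff (Fintype.card ι - t) := by
  unfold sigma Matrix.charpoly Matrix.charmatrix
  congr 2
  ext i j : 2
  simp [Matrix.scalar_apply, Matrix.diagonal_apply, Matrix.one_apply, add_comm]

lemma sigma_mul_comm (t : ℕ) (X Y : Matrix ι ι A) : sigma t (X * Y) = sigma t (Y * X) := by
  rw [sigma_eq_charpoly, sigma_eq_charpoly, ← neg_mul, Matrix.charpoly_mul_comm, mul_neg]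

lemma sigma_transpose (t : ℕ) (X : Matrix ι ι A) : sigma t X.transpose = sigma t X := by
  rw [sigma_eq_charpoly, sigma_eq_charpoly, ← Matrix.transpose_neg, Matrix.charpoly_transpose]

lemma sigma_map {B : Type*} [CommRing B] (f : A →+* B) (t : ℕ) (X : Matrix ι ι A) :
    f (sigma t X) = sigma t (X.map f) := by
  have h : -(X.map f) = (-X).map f := by ext i j; simp
  rw [sigma_eq_charpoly, sigma_eq_charpoly, h, Matrix.charpoly_map, Polynomial.coeff_map]

lemma sympTranspose_mul {m : ℕ} (X Y : Matrix (Fin m ⊕ Fin m) (Fin m ⊕ Fin m) A) :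
    sympTranspose (X * Y) = sympTranspose Y * sympTranspose X := by
  have hJ := Matrix.J_squared (Fin m) A
  simp only [sympTranspose, Matrix.transpose_mul, neg_mul_neg]
  calc -(Matrix.J (Fin m) A * (Y.transpose * X.transpose) * Matrix.J (Fin m) A)
      = Matrix.J (Fin m) A * Y.transpose * (-1) * X.transpose * Matrix.J (Fin m) A := by
        simp [Matrix.mul_assoc]
    _ = _ := by rw [← hJ]; simp only [Matrix.mul_assoc]

lemma sympTranspose_one {m : ℕ} :
    sympTranspose (1 : Matrix (Fin m ⊕ Fin m) (Fin m ⊕ Fin m) A) = 1 := by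
  simp [sympTranspose, Matrix.J_squared]

lemma sympTranspose_sympTranspose {m : ℕ} (X : Matrix (Fin m ⊕ Fin m) (Fin m ⊕ Fin m) A) :
    sympTranspose (sympTranspose X) = X := by
  have hJ := Matrix.J_squared (Fin m) A
  simp only [sympTranspose, Matrix.transpose_neg, Matrix.transpose_mul, Matrix.J_transpose,
    Matrix.transpose_transpose]
  calc _ = -((Matrix.J (Fin m) A * Matrix.J (Fin m) A) * X *
        -(Matrix.J (Fin m) A * Matrix.J (Fin m) A)) := by
        simp [Matrix.mul_assoc]
    _ = X := by rw [hJ]; simp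

lemma sigma_sympTranspose {m : ℕ} (t : ℕ) (X : Matrix (Fin m ⊕ Fin m) (Fin m ⊕ Fin m) A) :
    sigma t (sympTranspose X) = sigma t X := by
  have h : sympTranspose X = (-(Matrix.J (Fin m) A)) * (X.transpose * Matrix.J (Fin m) A) := by
    simp [sympTranspose, Matrix.mul_assoc]
  rw [h, sigma_mul_comm, Matrix.mul_assoc, Matrix.mul_neg, Matrix.J_squared, neg_neg,
    Matrix.mul_one, sigma_transpose]

lemma wordEval_tr {d : ℕ} {δ : Matrix ι ι A → Matrix ι ι A} (h1 : δ 1 = 1)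
    (hmul : ∀ Y Z, δ (Y * Z) = δ Z * δ Y) (hinv : ∀ Y, δ (δ Y) = Y)
    (X : Fin d → Matrix ι ι A) (a : Word d) :
    wordEval δ X a.tr = δ (wordEval δ X a) := by
  induction a using FreeMonoid.inductionOn' with
  | one => simp [Word.tr, h1]
  | of_mul b a ih =>
    have e : Word.tr (FreeMonoid.of b * a) = Word.tr a * FreeMonoid.of (Letter.tr b) := by
      simp [Word.tr]
    have hb : wordEval δ X (FreeMonoid.of (Letter.tr b)) = δ (wordEval δ X (FreeMonoid.of b)) := by
      rcases b with ⟨k, _ | _⟩ <;> simp [wordEval, Letter.tr, hinv]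
    rw [e, map_mul, map_mul, hmul, ih, hb]

lemma sigma_wordEval_congr {d : ℕ} {δ : Matrix ι ι A → Matrix ι ι A} (h1 : δ 1 = 1)
    (hmul : ∀ Y Z, δ (Y * Z) = δ Z * δ Y) (hinv : ∀ Y, δ (δ Y) = Y)
    (hσ : ∀ t Y, sigma t (δ Y) = sigma t Y) (X : Fin d → Matrix ι ι A) (t : ℕ)
    {a b : Word d} (h : WordEquiv a b) :
    sigma t (wordEval δ X a) = sigma t (wordEval δ X b) := by
  have key : ∀ a b : Word d, CycEquiv a b →
      sigma t (wordEval δ X a) = sigma t (wordEval δ X b) := by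
    intro a b h
    obtain ⟨u, v, hu, hv⟩ : ∃ u v : Word d, a = u * v ∧ b = v * u := by
      obtain ⟨k, hk, hk'⟩ := List.isRotated_iff_mod.1 h
      refine ⟨FreeMonoid.ofList ((FreeMonoid.toList a).take k),
        FreeMonoid.ofList ((FreeMonoid.toList a).drop k), ?_, ?_⟩
      · apply FreeMonoid.toList.injective; simp
      · apply FreeMonoid.toList.injective
        rw [← hk', List.rotate_eq_drop_append_take hk]; simp
    rw [hu, hv, map_mul, map_mul, sigma_mul_comm]
  rcases h with h | h
  · exact key _ _ h
  · rw [key _ _ h, wordEval_tr h1 hmul hinv, hσ]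

end Matrices

/-! ### The coordinate ring of `d`-tuples of matrices and its invariants -/

section Invariants

variable (F : Type*) [Field F] (d : ℕ) (ι : Type*) [Fintype ι] [DecidableEq ι]

/-- The coordinate ring `F[x_{ij}(k)]`; the variable `x_{ij}(k)` has index `(i, j, k)`. -/
abbrev CoordRing : Type _ := MvPolynomial (ι × ι × Fin d) F

variable {ι}

/-- The generic matrix `X_k`. -/
def genericMatrix (k : Fin d) : Matrix ι ι (CoordRing F d ι) :=
  Matrix.of fun i j => MvPolynomial.X (i, j, k)

variable {F}

/-- The action of an invertible matrix `g` on the coordinate ring: `g · x_{ij}(k)` is the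
`(i, j)` entry of `g⁻¹ X_k g`. -/
def coordAct (g : (Matrix ι ι F)ˣ) : CoordRing F d ι →ₐ[F] CoordRing F d ι :=
  MvPolynomial.aeval fun v : ι × ι × Fin d =>
    ((g⁻¹).val.map MvPolynomial.C * genericMatrix F d v.2.2 * g.val.map MvPolynomial.C :
      Matrix ι ι (CoordRing F d ι)) v.1 v.2.1

/-- The algebra `R^G` of matrix invariants of a group `G` of invertible matrices. -/
def matrixInvariants (G : Submonoid (Matrix ι ι F)) : Subalgebra F (CoordRing F d ι) where
  carrier := {f | ∀ g : (Matrix ι ι F)ˣ, g.val ∈ G → coordAct d g f = f}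
  mul_mem' ha hb g hg := by rw [map_mul, ha g hg, hb g hg]
  add_mem' ha hb g hg := by rw [map_add, ha g hg, hb g hg]
  algebraMap_mem' r g _ := AlgHom.commutes _ r

lemma sigma_wordEval_mem {δ : Matrix ι ι (CoordRing F d ι) → Matrix ι ι (CoordRing F d ι)}
    (G : Submonoid (Matrix ι ι F))
    (hmap : ∀ (f : CoordRing F d ι →ₐ[F] CoordRing F d ι) Y, (δ Y).map f = δ (Y.map f))
    (hconj : ∀ g : (Matrix ι ι F)ˣ, g.val ∈ G → ∀ Y,
      δ ((g⁻¹).val.map MvPolynomial.C * Y * g.val.map MvPolynomial.C) =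
        (g⁻¹).val.map MvPolynomial.C * δ Y * g.val.map MvPolynomial.C)
    (t : ℕ) (a : Word d) :
    sigma t (wordEval δ (genericMatrix F d) a) ∈ matrixInvariants d G := by
  intro g hg
  have hgg : (g.val.map MvPolynomial.C : Matrix ι ι (CoordRing F d ι)) *
      (g⁻¹).val.map MvPolynomial.C = 1 := by
    rw [← Matrix.map_mul, Units.mul_inv, Matrix.map_one _ (map_zero _) (map_one _)]
  have hgg' : ((g⁻¹).val.map MvPolynomial.C : Matrix ι ι (CoordRing F d ι)) *
      g.val.map MvPolynomial.C = 1 := by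
    rw [← Matrix.map_mul, Units.inv_mul, Matrix.map_one _ (map_zero _) (map_one _)]
  have hX : ∀ k, (genericMatrix F d k).map (coordAct d g) =
      (g⁻¹).val.map MvPolynomial.C * genericMatrix F d k * g.val.map MvPolynomial.C := by
    intro k
    ext1 i j
    simp [genericMatrix, coordAct]
  have hw : (wordEval δ (genericMatrix F d) a).map (coordAct d g) =
      (g⁻¹).val.map MvPolynomial.C * wordEval δ (genericMatrix F d) a *
        g.val.map MvPolynomial.C := by
    induction a using FreeMonoid.inductionOn' with
    | one =>
      rw [map_one, Matrix.map_one _ (map_zero _) (map_one _), Matrix.mul_one, hgg']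
    | of_mul b a ih =>
      have hb : (wordEval δ (genericMatrix F d) (FreeMonoid.of b)).map (coordAct d g) =
          (g⁻¹).val.map MvPolynomial.C * wordEval δ (genericMatrix F d) (FreeMonoid.of b) *
            g.val.map MvPolynomial.C := by
        rcases b with ⟨k, _ | _⟩
        · simpa [wordEval] using hX k
        · simpa [wordEval, hmap, hX] using hconj g hg (genericMatrix F d k)
      rw [map_mul, Matrix.map_mul, ih, hb]
      simp only [Matrix.mul_assoc]
      rw [← Matrix.mul_assoc (g.val.map _) ((g⁻¹).val.map _), hgg, Matrix.one_mul]
  have := sigma_map (coordAct d g : CoordRing F d ι →+* CoordRing F d ι) t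
    (wordEval δ (genericMatrix F d) a)
  refine this.trans ?_
  refine (congrArg (sigma t) hw).trans ?_
  rw [sigma_mul_comm, ← Matrix.mul_assoc, hgg, Matrix.one_mul]

end Invariants

/-! ### The homomorphisms `Ψ_n` and the ideals of relations -/

section Relations

variable (F : Type*) [Field F] (d : ℕ)

lemma transpose_conj {n : ℕ} (g : (Matrix (Fin n) (Fin n) F)ˣ)
    (hg : g.val ∈ Matrix.orthogonalGroup (Fin n) F)
    (Y : Matrix (Fin n) (Fin n) (CoordRing F d (Fin n))) :
    ((g⁻¹).val.map MvPolynomial.C * Y * g.val.map MvPolynomial.C).transpose =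
      (g⁻¹).val.map MvPolynomial.C * Y.transpose * g.val.map MvPolynomial.C := by
  have h : (g⁻¹).val = g.val.transpose :=
    Units.inv_eq_of_mul_eq_one_right ((Matrix.mem_orthogonalGroup_iff (Fin n) F).1 hg)
  rw [h, Matrix.transpose_mul, Matrix.transpose_mul, Matrix.transpose_map,
    Matrix.transpose_transpose, Matrix.mul_assoc]

lemma sympTranspose_map {m : ℕ} {A B : Type*} [CommRing A] [CommRing B] (f : A →+* B)
    (Y : Matrix (Fin m ⊕ Fin m) (Fin m ⊕ Fin m) A) :
    (sympTranspose Y).map f = sympTranspose (Y.map f) := by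
  have hn : ∀ W : Matrix (Fin m ⊕ Fin m) (Fin m ⊕ Fin m) A, (-W).map f = -(W.map f) := by
    intro W; ext1 i j; simp
  rw [sympTranspose, sympTranspose, hn, Matrix.map_mul, Matrix.map_mul, Matrix.transpose_map,
    Matrix.map_J]

lemma sympTranspose_conj {m : ℕ} (g : (Matrix (Fin m ⊕ Fin m) (Fin m ⊕ Fin m) F)ˣ)
    (hg : g.val ∈ Matrix.symplecticGroup (Fin m) F)
    (Y : Matrix (Fin m ⊕ Fin m) (Fin m ⊕ Fin m) (CoordRing F d (Fin m ⊕ Fin m))) :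
    sympTranspose ((g⁻¹).val.map MvPolynomial.C * Y * g.val.map MvPolynomial.C) =
      (g⁻¹).val.map MvPolynomial.C * sympTranspose Y * g.val.map MvPolynomial.C := by
  have h : (g⁻¹).val = sympTranspose g.val := by
    refine Units.inv_eq_of_mul_eq_one_left ?_
    have := SymplecticGroup.inv_left_mul_aux hg
    simpa [sympTranspose] using this
  have hm : ∀ Z : Matrix (Fin m ⊕ Fin m) (Fin m ⊕ Fin m) F,
      (sympTranspose Z).map (MvPolynomial.C (σ := (Fin m ⊕ Fin m) × (Fin m ⊕ Fin m) × Fin d)) =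
        sympTranspose (Z.map MvPolynomial.C) :=
    fun Z => sympTranspose_map MvPolynomial.C Z
  rw [sympTranspose_mul, sympTranspose_mul, h, hm, sympTranspose_sympTranspose, Matrix.mul_assoc]

/-- The algebra `R^{O(n)}`. -/
abbrev invariantsO (n : ℕ) : Subalgebra F (CoordRing F d (Fin n)) :=
  matrixInvariants d (Matrix.orthogonalGroup (Fin n) F)

/-- The algebra `R^{Sp(n)}` for `n = 2m`. -/
abbrev invariantsSp (m : ℕ) : Subalgebra F (CoordRing F d (Fin m ⊕ Fin m)) :=
  matrixInvariants d (Matrix.symplecticGroup (Fin m) F)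

lemma sigma_transpose_mem (n t : ℕ) (a : Word d) :
    sigma t (wordEval Matrix.transpose (genericMatrix F d) a) ∈ invariantsO F d n := by
  refine sigma_wordEval_mem d _ ?_ ?_ t a
  · intro f Y; exact Matrix.transpose_map.symm
  · intro g hg Y; exact transpose_conj F d g hg Y

lemma sigma_sympTranspose_mem (m t : ℕ) (a : Word d) :
    sigma t (wordEval sympTranspose (genericMatrix F d) a) ∈ invariantsSp F d m := by
  refine sigma_wordEval_mem d _ ?_ ?_ t a
  · intro f Y; exact sympTranspose_map f.toRingHom Y
  · intro g hg Y; exact sympTranspose_conj F d g hg Y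

/-- `σ_t(X_a)` for `G = O(n)`, as a function of the class of the primitive word `a`. -/
def sigmaO (n t : ℕ) (q : PrimClass d) : invariantsO F d n :=
  Quotient.liftOn q
    (fun a => ⟨sigma t (wordEval Matrix.transpose (genericMatrix F d) a.1),
      sigma_transpose_mem F d n t a.1⟩)
    (fun _ _ h => Subtype.ext (sigma_wordEval_congr Matrix.transpose_one
      Matrix.transpose_mul Matrix.transpose_transpose sigma_transpose _ t h))

/-- `σ_t(X_a)` for `G = Sp(n)`, `n = 2m`, as a function of the class of the primitive word `a`. -/
def sigmaSp (m t : ℕ) (q : PrimClass d) : invariantsSp F d m :=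
  Quotient.liftOn q
    (fun a => ⟨sigma t (wordEval sympTranspose (genericMatrix F d) a.1),
      sigma_sympTranspose_mem F d m t a.1⟩)
    (fun _ _ h => Subtype.ext (sigma_wordEval_congr sympTranspose_one
      sympTranspose_mul sympTranspose_sympTranspose sigma_sympTranspose _ t h))

/-- The homomorphism `Ψ_n` for `G = O(n)`: it sends `σ_t(a)` to `σ_t(X_a)` if `t ≤ n`, and to `0`
otherwise. -/
def psiO (n : ℕ) : NSigma F d →ₐ[F] invariantsO F d n :=
  MvPolynomial.aeval fun v : ℕ+ × PrimClass d =>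
    if (v.1 : ℕ) ≤ n then sigmaO F d n v.1 v.2 else 0

/-- The homomorphism `Ψ_n` for `G = Sp(n)`, `n = 2m`: it sends `σ_t(a)` to `σ_t(X_a)` if `t ≤ n`,
and to `0` otherwise. -/
def psiSp (m : ℕ) : NSigma F d →ₐ[F] invariantsSp F d m :=
  MvPolynomial.aeval fun v : ℕ+ × PrimClass d =>
    if (v.1 : ℕ) ≤ 2 * m then sigmaSp F d m v.1 v.2 else 0

/-- The ideal `K_n` of relations for `R^{O(n)}`. -/
def relationsO (n : ℕ) : Ideal (NSigma F d) := RingHom.ker (psiO F d n)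

/-- The ideal `K_n` of relations for `R^{Sp(n)}`, `n = 2m`. -/
def relationsSp (m : ℕ) : Ideal (NSigma F d) := RingHom.ker (psiSp F d m)

/-- The ideal `K_∞` of free relations for `G = O(n)`: the intersection of all `K_n`, `n > 0`. -/
def freeRelationsO : Ideal (NSigma F d) := ⨅ (n : ℕ) (_ : 0 < n), relationsO F d n

/-- The ideal `K_∞` of free relations for `G = Sp(n)`: the intersection of all `K_n`, where
`n = 2m > 0` is even. -/
def freeRelationsSp : Ideal (NSigma F d) := ⨅ (m : ℕ) (_ : 0 < m), relationsSp F d m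

end Relations

end FreeRel

end

noncomputable section

namespace FreeRel

open Polynomial

/-! Let `K` be the algebraic closure of `F`. A free relation `f` vanishes whenever each `σ_t(a)` is
replaced by the `t`-th coefficient of `det (1 + λ X_a)`, for matrices `X_k` over `K` of any
admissible size. Since `K` is infinite, it suffices that these coefficients can be prescribed
arbitrarily for the finitely many pairs `(t, [a])` occurring in `f`.

The involution is removed by a hyperbolic construction. Take independent `m × m` matrices `B b`, one
for each of the `2d` letters, and form the block diagonal matrices `diag(B b, (B bᵀ)ᵀ)`. The
symplectic transpose exchanges the blocks for `x_k` and `x_kᵀ`; the ordinary transpose does the same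
after a change of basis that uses a square root of `-1` and the inverse of `2`. The word `a` then
has `det (1 + λ B_a) det (1 + λ B_{aᵀ})` as its polynomial (`detPoly_lift_hyperbolic`).

For one primitive word `a`, label the edges of a directed cycle by the letters of `a` and put a
matrix `Z` on one edge. Primitivity forces `a` to be readable from a single vertex only, so its
polynomial is `det (1 + λ Z)`, which can be any polynomial with constant term `1`. A primitive word
that is not a rotation of `a` acts nilpotently and has polynomial `1` (`exists_cycle_block`). Direct
sums over finitely many classes multiply these polynomials. If `aᵀ` is a rotation of `a`, the class
of `a` sees the square of the chosen polynomial, so truncated square roots are needed; they exist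
because `2 ≠ 0` (`exists_sq_coeff_eq`). -/

/-- The polynomial `det (1 + λ M)`. -/
def detPoly {ι A : Type*} [Fintype ι] [DecidableEq ι] [CommRing A] (M : Matrix ι ι A) : A[X] :=
  (1 + (X : A[X]) • M.map C).det

/-! ### Formal properties of `det (1 + λ M)` -/

section DetPoly

variable {ι κ A : Type*} [Fintype ι] [DecidableEq ι] [Fintype κ] [DecidableEq κ] [CommRing A]

lemma detPoly_eq_charpolyRev (M : Matrix ι ι A) : detPoly M = (-M).charpolyRev := by
  have : (-M).map (C : A → A[X]) = -(M.map C) := by ext1 i j; simp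
  simp [detPoly, Matrix.charpolyRev, this]

/-- The polynomial `det (1 + λ M)` is the reversal of a characteristic polynomial of degree `n`. Its
coefficients beyond `n` vanish, which matches the convention `Ψ_n(σ_t(a)) = 0` for `t > n`. -/
lemma sigma_eq_coeff_detPoly {t : ℕ} (M : Matrix ι ι A) :
    (if t ≤ Fintype.card ι then sigma t M else 0) = (detPoly M).coeff t := by
  nontriviality A
  rw [detPoly_eq_charpolyRev, ← Matrix.reverse_charpoly, Polynomial.coeff_reverse,
    Matrix.charpoly_natDegree_eq_dim, sigma_eq_charpoly]
  split_ifs with h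
  · rw [Polynomial.revAt_le h]
  · rw [Polynomial.revAt_eq_self_of_lt (not_le.1 h), Polynomial.coeff_eq_zero_of_natDegree_lt]
    rw [Matrix.charpoly_natDegree_eq_dim]; exact not_le.1 h

lemma detPoly_mul_comm (M : Matrix ι κ A) (N : Matrix κ ι A) :
    detPoly (M * N) = detPoly (N * M) := by
  have h1 : (X : A[X]) • (M * N).map C = ((X : A[X]) • M.map C) * N.map C := by
    rw [Matrix.smul_mul, Matrix.map_mul]
  have h2 : (X : A[X]) • (N * M).map C = N.map C * ((X : A[X]) • M.map C) := by
    rw [Matrix.mul_smul, Matrix.map_mul]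
  rw [detPoly, detPoly, h1, h2, Matrix.det_one_add_mul_comm]

lemma detPoly_transpose (M : Matrix ι ι A) : detPoly M.transpose = detPoly M := by
  rw [detPoly, detPoly, ← Matrix.det_transpose]
  simp [Matrix.transpose_map]

lemma detPoly_fromBlocks (M : Matrix ι ι A) (N : Matrix κ κ A) :
    detPoly (Matrix.fromBlocks M 0 0 N) = detPoly M * detPoly N := by
  rw [detPoly, detPoly, detPoly, ← Matrix.det_fromBlocks_zero₂₁ _ 0]
  congr 1
  rw [← Matrix.fromBlocks_one, Matrix.fromBlocks_map, Matrix.fromBlocks_smul,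
    Matrix.fromBlocks_add]
  simp

lemma detPoly_reindex (e : ι ≃ κ) (M : Matrix ι ι A) :
    detPoly (Matrix.reindexAlgEquiv A A e M) = detPoly M := by
  rw [detPoly, detPoly, ← Matrix.det_reindexAlgEquiv A[X] A[X] e (1 + _)]
  congr 1
  rw [map_add, map_one, map_smul]
  rfl

lemma detPoly_zero : detPoly (0 : Matrix ι ι A) = 1 := by
  simp [detPoly, Matrix.map_zero]

lemma coeff_zero_detPoly (M : Matrix ι ι A) : (detPoly M).coeff 0 = 1 := by
  rw [detPoly_eq_charpolyRev, Polynomial.coeff_zero_eq_eval_zero, Matrix.eval_charpolyRev]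

/-- For nilpotent `M` the polynomial is a unit of `A[X]`, hence constant over a domain, and its
constant term is `1`. -/
lemma detPoly_of_isNilpotent [IsDomain A] {M : Matrix ι ι A} (h : IsNilpotent M) :
    detPoly M = 1 := by
  have hu := Matrix.isUnit_charpolyRev_of_isNilpotent h.neg
  rw [← detPoly_eq_charpolyRev] at hu
  rw [Polynomial.eq_C_of_degree_eq_zero (Polynomial.degree_eq_zero_of_isUnit hu),
    coeff_zero_detPoly, map_one]

end DetPoly

/-- Every polynomial with constant term `1` is `det (1 + λ Z)` for some matrix `Z`. -/
lemma exists_detPoly_eq {K : Type*} [Field K] (P : K[X]) (hP : P.coeff 0 = 1) :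
    ∃ (n : ℕ) (Z : Matrix (Fin n) (Fin n) K), detPoly Z = P := by
  have hrev : P.reverse.natDegree = P.natDegree := by
    rw [Polynomial.reverse_natDegree, Polynomial.natTrailingDegree_eq_zero.2 (Or.inr (by simp [hP])),
      Nat.sub_zero]
  have hm : P.reverse.Monic := by
    rw [Polynomial.Monic, Polynomial.reverse_leadingCoeff, Polynomial.trailingCoeff,
      Polynomial.natTrailingDegree_eq_zero.2 (Or.inr (by simp [hP])), hP]
  -- The reversal of `P` is monic, so it is the characteristic polynomial of multiplication by the
  -- root in `K[X]/(P.reverse)`. The sign of `Z` compensates the one in `detPoly_eq_charpolyRev`.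
  let pb := AdjoinRoot.powerBasis hm.ne_zero
  refine ⟨pb.dim, -(Algebra.leftMulMatrix pb.basis pb.gen), ?_⟩
  rw [detPoly_eq_charpolyRev, neg_neg, ← Matrix.reverse_charpoly, charpoly_leftMulMatrix,
    AdjoinRoot.minpoly_powerBasis_gen_of_monic hm]
  rw [Polynomial.reverse, hrev, Polynomial.reverse]
  ext k
  rw [Polynomial.coeff_reflect, Polynomial.coeff_reflect, Polynomial.revAt_invol]

/-- Square roots of polynomials modulo `λ ^ (T + 1)` when `2 ≠ 0`. -/
lemma exists_sq_coeff_eq {K : Type*} [Field K] (h2 : (2 : K) ≠ 0) (s : ℕ → K) (T : ℕ) :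
    ∃ P : K[X], P.coeff 0 = 1 ∧ ∀ t, 0 < t → t ≤ T → (P * P).coeff t = s t := by
  induction T with
  | zero => exact ⟨1, by simp, fun t h h' => by omega⟩
  | succ T ih =>
    obtain ⟨P, hP, h⟩ := ih
    -- As `P` has constant term `1`, adding `c λ ^ (T + 1)` changes the coefficient of `λ ^ (T + 1)`
    -- in the square by `2c` and leaves all lower ones unchanged.
    set c := (s (T + 1) - (P * P).coeff (T + 1)) / 2 with hc
    refine ⟨P + C c * X ^ (T + 1), by simp [hP], fun t ht htT => ?_⟩
    have e : (P + C c * X ^ (T + 1)) * (P + C c * X ^ (T + 1)) =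
        P * P + (C (2 * c) * P + C (c * c) * X ^ (T + 1)) * X ^ (T + 1) := by
      simp only [map_mul, map_ofNat]; ring
    rw [e, Polynomial.coeff_add, Polynomial.coeff_mul_X_pow']
    rcases Nat.lt_or_ge t (T + 1) with h' | h'
    · rw [if_neg (by omega), add_zero, h t ht (by omega)]
    · obtain rfl : t = T + 1 := by omega
      simp [hP, hc]
      field_simp
      ring

lemma exists_coeff_eq {K : Type*} [Field K] (s : ℕ → K) (T : ℕ) :
    ∃ P : K[X], P.coeff 0 = 1 ∧ ∀ t, 0 < t → t ≤ T → P.coeff t = s t := by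
  refine ⟨∑ t ∈ Finset.range (T + 1), C (if t = 0 then 1 else s t) * X ^ t, ?_, ?_⟩
  · simp [Polynomial.finsetSum_coeff, Polynomial.coeff_X_pow]
  · intro t ht htT
    simp only [Polynomial.finsetSum_coeff, Polynomial.coeff_C_mul, Polynomial.coeff_X_pow]
    rw [Finset.sum_eq_single t (by simp +contextual [eq_comm]) (by simp; omega)]
    simp [ht.ne']

/-! ### Segments of periodic sequences and primitive words -/

/-- The word `f i, f (i + 1), …, f (i + n - 1)`. -/
def seg {d : ℕ} (f : ℤ → Letter d) (i : ℤ) (n : ℕ) : Word d :=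
  FreeMonoid.ofList ((List.range n).map fun k : ℕ => f (i + k))

section Words

variable {d : ℕ} {f : ℤ → Letter d}

lemma length_seg (f : ℤ → Letter d) (i : ℤ) (n : ℕ) : (seg f i n).length = n := by
  simp [seg, FreeMonoid.length]

lemma seg_add (f : ℤ → Letter d) (i : ℤ) (m n : ℕ) :
    seg f i (m + n) = seg f i m * seg f (i + m) n := by
  apply FreeMonoid.toList.injective
  simp [seg, List.range_add, add_assoc, Function.comp_def]

lemma seg_succ (f : ℤ → Letter d) (i : ℤ) (n : ℕ) :
    seg f i (n + 1) = FreeMonoid.of (f i) * seg f (i + 1) n := by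
  rw [add_comm, seg_add]
  simp [seg]

lemma seg_congr {g : ℤ → Letter d} {i j : ℤ} {n : ℕ} :
    seg f i n = seg g j n ↔ ∀ k < n, f (i + k) = g (j + k) := by
  simp [seg]

lemma seg_add_period {c : ℤ} (h : Function.Periodic f c) (i : ℤ) (n : ℕ) :
    seg f (i + c) n = seg f i n := by
  rw [seg_congr]
  intro k _
  rw [add_right_comm, h]

lemma seg_mul_period {c : ℕ} (h : Function.Periodic f c) (i : ℤ) (k : ℕ) :
    seg f i (k * c) = seg f i c ^ k := by
  induction k with
  | zero => simp [seg]
  | succ k ih =>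
    have hk : Function.Periodic f ((k * c : ℕ) : ℤ) := by
      simpa using h.int_mul k
    rw [Nat.succ_mul, seg_add, ih, seg_add_period hk, pow_succ]

lemma periodic_gcd {a b : ℕ} (ha : Function.Periodic f a) (hb : Function.Periodic f b) :
    Function.Periodic f (Nat.gcd a b : ℕ) := by
  rw [Nat.gcd_eq_gcd_ab]
  have h1 := ha.int_mul (Nat.gcdA a b)
  have h2 := hb.int_mul (Nat.gcdB a b)
  simpa [mul_comm] using h1.add_period h2

/-- Every nonempty word is a segment of a periodic sequence. -/
lemma exists_periodic {a : Word d} (ha : a ≠ 1) :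
    ∃ f : ℤ → Letter d, Function.Periodic f (a.length : ℕ) ∧ seg f 0 a.length = a := by
  have hpos : 0 < a.length := by
    rw [Nat.pos_iff_ne_zero]; simpa using ha
  have hlt : ∀ k : ℤ, (k % (a.length : ℤ)).toNat < (FreeMonoid.toList a).length := by
    intro k
    have h1 := Int.emod_lt_of_pos k (Int.natCast_pos.2 hpos)
    have h2 := Int.emod_nonneg k (Int.natCast_pos.2 hpos).ne'
    change _ < a.length
    omega
  refine ⟨fun k => (FreeMonoid.toList a)[(k % (a.length : ℤ)).toNat]'(hlt k), fun k => by simp, ?_⟩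
  apply FreeMonoid.toList.injective
  refine List.ext_getElem (by simp [seg, FreeMonoid.length]) fun k h1 h2 => ?_
  have h3 : ((k : ℤ) % (a.length : ℤ)).toNat = k := by
    change k < a.length at h2
    rw [Int.emod_eq_of_lt (by omega) (Int.ofNat_lt.2 h2)]; simp
  simp [seg, h3]

/-- The minimal period of a sequence built from a primitive word is the length of the word. -/
lemma IsPrimitiveWord.dvd_of_periodic {a : Word d} (ha : IsPrimitiveWord a) {i : ℤ}
    (hf : seg f i a.length = a) (h : Function.Periodic f a.length) {c : ℕ}
    (hc : Function.Periodic f c) : a.length ∣ c := by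
  have hpos : 0 < a.length := by
    rw [Nat.pos_iff_ne_zero]; simpa using ha.1
  have hg := periodic_gcd h hc
  by_contra hn
  have hlt : Nat.gcd a.length c < a.length := by
    refine lt_of_le_of_ne (Nat.gcd_le_left _ hpos) fun he => hn ?_
    rw [← he]; exact Nat.gcd_dvd_right _ _
  -- The gcd of the two periods is a period properly dividing the length, so the word is a power of
  -- its initial segment of that length.
  refine ha.2 ⟨seg f i (Nat.gcd a.length c), a.length / Nat.gcd a.length c, ?_, ?_⟩
  · rwa [length_seg]
  · rw [← seg_mul_period hg, Nat.div_mul_cancel (Nat.gcd_dvd_left _ _), hf]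

lemma cycEquiv_seg {r : ℕ} (hr : 0 < r) (h : Function.Periodic f r) (i : ℤ) :
    CycEquiv (seg f i r) (seg f 0 r) := by
  have hr' : (0 : ℤ) < r := by exact_mod_cast hr
  obtain ⟨j, hj⟩ : ∃ j : ℕ, i % r = j :=
    Int.eq_ofNat_of_zero_le (Int.emod_nonneg _ hr'.ne')
  have hjr : j < r := by have := Int.emod_lt_of_pos i hr'; omega
  have e : seg f i r = seg f j r := by
    have := h.int_mul (i / r)
    rw [← hj, ← seg_add_period this (i % r)]
    congr 1
    rw [mul_comm]; exact (Int.emod_add_mul_ediv i r).symm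
  obtain ⟨k, rfl⟩ := Nat.exists_eq_add_of_le hjr.le
  rw [e, seg_add f 0, zero_add, add_comm j k, seg_add]
  have e2 : seg f (j + k) j = seg f 0 j := by
    rw [← seg_add_period h 0]; simp
  rw [e2]
  exact List.isRotated_append

lemma Word.tr_mul (a b : Word d) : (a * b).tr = b.tr * a.tr := by
  apply FreeMonoid.toList.injective
  simp [Word.tr]

lemma Word.tr_one : (1 : Word d).tr = 1 := by simp [Word.tr]

lemma Word.tr_pow (a : Word d) (k : ℕ) : (a ^ k).tr = a.tr ^ k := by
  induction k with
  | zero => simp [Word.tr_one]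
  | succ k ih => rw [pow_succ, Word.tr_mul, ih, pow_succ']

lemma Word.length_tr (a : Word d) : a.tr.length = a.length := by
  simp [Word.tr, FreeMonoid.length]

lemma IsPrimitiveWord.tr {a : Word d} (ha : IsPrimitiveWord a) : IsPrimitiveWord a.tr := by
  refine ⟨fun h => ha.1 ?_, ?_⟩
  · rw [← Word.tr_tr a, h, Word.tr_one]
  · rintro ⟨b, k, hb, h⟩
    refine ha.2 ⟨b.tr, k, ?_, ?_⟩
    · rwa [Word.length_tr, ← Word.length_tr a]
    · rw [← Word.tr_tr a, h, Word.tr_pow]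

end Words

/-! ### Matrices on a cycle labelled by a primitive word -/

section Cycle

variable {d : ℕ} {K : Type*} [Field K] {r T : ℕ} [NeZero r]

/-- The matrix of the edges with label `b` in the cycle of length `r` whose edge from `i` to
`i + 1` has label `f i`; the edge from `0` to `1` has weight `Z`, all others have weight `1`. -/
def cycleMatrix (f : ℤ → Letter d) (Z : Matrix (Fin T) (Fin T) K) (b : Letter d) :
    Matrix (ZMod r × Fin T) (ZMod r × Fin T) K :=
  Matrix.of fun p q =>
    if f p.1.val = b ∧ q.1 = p.1 + 1 then (if p.1 = 0 then Z else 1) p.2 q.2 else 0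

variable {f : ℤ → Letter d} {Z : Matrix (Fin T) (Fin T) K}

lemma apply_val_cast (hf : Function.Periodic f r) (i : ℤ) : f ((i : ZMod r).val : ℤ) = f i := by
  rw [ZMod.val_intCast]
  have := hf.int_mul (i / r) (i % r)
  rw [← this]
  congr 1
  rw [mul_comm]; exact Int.emod_add_mul_ediv i r

/-- Each vertex has exactly one outgoing edge. A word contributes to row `i` only by spelling the
labels met from `i` onwards, and the column is then the vertex reached. -/
lemma eq_seg_of_apply_ne_zero (hf : Function.Periodic f r) (b : Word d) (i : ℤ)
    (u : Fin T) (q : ZMod r × Fin T)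
    (h : FreeMonoid.lift (cycleMatrix (r := r) f Z) b ((i : ZMod r), u) q ≠ 0) :
    b = seg f i b.length ∧ q.1 = ((i + b.length : ℤ) : ZMod r) := by
  induction b using FreeMonoid.inductionOn' generalizing i u with
  | one =>
    refine ⟨by simp [seg], ?_⟩
    by_contra hq
    rw [map_one, Matrix.one_apply_ne] at h
    · exact h rfl
    · rintro rfl; simp at hq
  | of_mul l b ih =>
    rw [map_mul, Matrix.mul_apply] at h
    obtain ⟨⟨x, w⟩, -, hx⟩ := Finset.exists_ne_zero_of_sum_ne_zero h
    have h1 := left_ne_zero_of_mul hx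
    have h2 := right_ne_zero_of_mul hx
    rw [FreeMonoid.lift_eval_of] at h1
    simp only [cycleMatrix, Matrix.of_apply, ne_eq, ite_eq_right_iff, Classical.not_imp] at h1
    obtain ⟨⟨h3, rfl⟩, -⟩ := h1
    rw [apply_val_cast hf] at h3
    subst h3
    have h4 : (i : ZMod r) + 1 = ((i + 1 : ℤ) : ZMod r) := by simp
    rw [h4] at h2
    obtain ⟨h5, h6⟩ := ih (i + 1) w h2
    rw [FreeMonoid.length_mul, FreeMonoid.length_of, add_comm 1, seg_succ, ← h5]
    refine ⟨rfl, ?_⟩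
    rw [h6]; push_cast; ring

/-- The inclusion of the block of `Fin T` at the vertex `i`. -/
def vertexRow (T : ℕ) (K : Type*) [Field K] (i : ZMod r) :
    Matrix (Fin T) (ZMod r × Fin T) K :=
  Matrix.of fun u q => if q = (i, u) then 1 else 0

lemma vertexRow_mul {κ : Type*} (i : ZMod r) (M : Matrix (ZMod r × Fin T) κ K) :
    vertexRow T K i * M = Matrix.of fun u q => M (i, u) q := by
  ext u q
  simp [vertexRow, Matrix.mul_apply]

lemma vertexRow_mul_transpose (i : ZMod r) :
    vertexRow T K i * (vertexRow T K i).transpose = 1 := by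
  rw [vertexRow_mul]
  ext u v
  simp [vertexRow, Matrix.one_apply]

lemma vertexRow_mul_cycleMatrix (hf : Function.Periodic f r) (i : ℤ) :
    vertexRow T K (i : ZMod r) * cycleMatrix (r := r) f Z (f i) =
      (if (i : ZMod r) = 0 then Z else 1) * vertexRow T K ((i + 1 : ℤ) : ZMod r) := by
  rw [vertexRow_mul]
  ext u ⟨x, v⟩
  simp only [cycleMatrix, Matrix.of_apply, apply_val_cast hf i, true_and]
  simp [Matrix.mul_apply, vertexRow, Prod.ext_iff, ite_and]

/-- A path that starts after vertex `0` and stops by the time it returns there never uses the edge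
of weight `Z`. -/
lemma vertexRow_mul_lift_seg (hf : Function.Periodic f r) (i n : ℕ) (hi : 0 < i) (hn : i + n ≤ r) :
    vertexRow T K (i : ZMod r) * FreeMonoid.lift (cycleMatrix (r := r) f Z) (seg f i n) =
      vertexRow T K ((i + n : ℕ) : ZMod r) := by
  induction n generalizing i with
  | zero => simp [seg]
  | succ n ih =>
    have h0 : ((i : ℤ) : ZMod r) ≠ 0 := by
      rw [Int.cast_natCast, Ne, ZMod.natCast_eq_zero_iff]
      exact fun h => absurd (Nat.le_of_dvd hi h) (by omega)
    have h := vertexRow_mul_cycleMatrix (T := T) (K := K) (Z := Z) hf i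
    rw [if_neg h0, Matrix.one_mul, Int.cast_natCast] at h
    rw [seg_succ, map_mul, FreeMonoid.lift_eval_of, ← Matrix.mul_assoc, h]
    have := ih (i + 1) (by omega) (by omega)
    push_cast at this ⊢
    rw [this]
    congr 1; ring

lemma vertexRow_zero_mul_lift_seg (hf : Function.Periodic f r) :
    vertexRow T K (0 : ZMod r) * FreeMonoid.lift (cycleMatrix (r := r) f Z) (seg f 0 r) =
      Z * vertexRow T K (0 : ZMod r) := by
  obtain ⟨n, rfl⟩ : ∃ n, r = n + 1 := Nat.exists_eq_succ_of_ne_zero (NeZero.ne r)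
  have h := vertexRow_mul_cycleMatrix (r := n + 1) (T := T) (K := K) (Z := Z) hf 0
  have h' := vertexRow_mul_lift_seg (r := n + 1) (T := T) (K := K) (Z := Z) hf 1 n one_pos
    (by omega)
  have h0 : ((1 + n : ℕ) : ZMod (n + 1)) = 0 := by rw [add_comm]; exact ZMod.natCast_self _
  rw [h0] at h'
  simp only [Int.cast_zero, if_true, zero_add, Int.cast_one, Nat.cast_one] at h h'
  rw [seg_succ, map_mul, FreeMonoid.lift_eval_of, ← Matrix.mul_assoc, h, Matrix.mul_assoc,
    zero_add, h']

lemma detPoly_lift_congr {ι : Type*} [Fintype ι] [DecidableEq ι]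
    (B : Letter d → Matrix ι ι K) {a b : Word d} (h : CycEquiv a b) :
    detPoly (FreeMonoid.lift B a) = detPoly (FreeMonoid.lift B b) := by
  obtain ⟨k, hk, hk'⟩ := List.isRotated_iff_mod.1 h
  have ha : a = FreeMonoid.ofList ((FreeMonoid.toList a).take k) *
      FreeMonoid.ofList ((FreeMonoid.toList a).drop k) := by
    apply FreeMonoid.toList.injective; simp
  have hb : b = FreeMonoid.ofList ((FreeMonoid.toList a).drop k) *
      FreeMonoid.ofList ((FreeMonoid.toList a).take k) := by
    apply FreeMonoid.toList.injective
    rw [← hk', List.rotate_eq_drop_append_take hk]; simp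
  rw [hb, map_mul, detPoly_mul_comm, ← map_mul, ← ha]

/-- Only the rows at vertex `0` are nonzero, and one trip around the cycle from there has weight
`Z`. The matrix is therefore `Eᵀ Z E` with `E Eᵀ = 1`, and `detPoly_mul_comm` leaves `Z`. -/
lemma detPoly_cycleMatrix_self {a : Word d} (ha : IsPrimitiveWord a) (hr : a.length = r)
    (hf : Function.Periodic f r) (hfa : seg f 0 r = a) :
    detPoly (FreeMonoid.lift (cycleMatrix (r := r) f Z) a) = detPoly Z := by
  have hrow := vertexRow_zero_mul_lift_seg (Z := Z) hf
  rw [hfa] at hrow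
  have key : FreeMonoid.lift (cycleMatrix (r := r) f Z) a =
      (vertexRow T K (0 : ZMod r)).transpose * (Z * vertexRow T K (0 : ZMod r)) := by
    rw [← hrow, vertexRow_mul]
    ext ⟨x, u⟩ q
    rw [Matrix.mul_apply]
    by_cases hx : x = 0
    · subst hx
      simp [vertexRow]
    · have h0 : FreeMonoid.lift (cycleMatrix (r := r) f Z) a (x, u) q = 0 := by
        by_contra hne
        have hxc : (((x.val : ℕ) : ℤ) : ZMod r) = x := by simp
        rw [← hxc] at hne
        have h1 := (eq_seg_of_apply_ne_zero hf a _ u q hne).1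
        -- The word `a` is read both from `0` and from `x`, so `f` is invariant under the shift by
        -- `x`. Primitivity makes `r` divide `x.val < r`.
        have hper : Function.Periodic f x.val := by
          have h2 : seg f x.val r = seg f 0 r := by rw [hfa]; conv_rhs => rw [h1, hr]
          rw [seg_congr] at h2
          intro k
          have hr' : (0 : ℤ) < r := by exact_mod_cast Nat.pos_of_ne_zero (NeZero.ne r)
          obtain ⟨j, hj⟩ : ∃ j : ℕ, k % r = j :=
            Int.eq_ofNat_of_zero_le (Int.emod_nonneg _ hr'.ne')
          have hjr : j < r := by have := Int.emod_lt_of_pos k hr'; omega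
          have h3 := h2 j hjr
          have hk : k = j + (k / r : ℤ) * r := by
            rw [← hj, mul_comm]; exact (Int.emod_add_mul_ediv k r).symm
          have h4 := hf.int_mul (k / r)
          simp only [Int.cast_id] at h4
          rw [hk, add_right_comm, h4, h4, add_comm, h3, zero_add]
        subst hr
        have := ha.dvd_of_periodic hfa hf hper
        have hv : x.val = 0 := Nat.eq_zero_of_dvd_of_lt this (ZMod.val_lt x)
        exact hx ((ZMod.val_eq_zero x).1 hv)
      rw [h0]
      simp [vertexRow, hx]
  rw [key, detPoly_mul_comm, Matrix.mul_assoc, vertexRow_mul_transpose, Matrix.mul_one]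

/-- If high powers of `b` could be read along the cycle, `f` would have period the length of `b`.
Primitivity of both words then gives them equal length and makes `b` a rotation of `a`. -/
lemma isNilpotent_cycleMatrix {a b : Word d} (ha : IsPrimitiveWord a) (hb : IsPrimitiveWord b)
    (hr : a.length = r) (hf : Function.Periodic f r) (hfa : seg f 0 r = a)
    (hab : ¬ CycEquiv b a) :
    IsNilpotent (FreeMonoid.lift (cycleMatrix (r := r) f Z) b) := by
  -- Here `r` copies of `b` fill a stretch of length `r * s`, which is a period of `f`; the extra
  -- copy allows a comparison with the shift by `s`.
  refine ⟨r + 1, ?_⟩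
  rw [← map_pow]
  by_contra hne
  apply hab
  obtain ⟨⟨x, u⟩, q, hne⟩ : ∃ p q, FreeMonoid.lift (cycleMatrix (r := r) f Z) (b ^ (r + 1)) p q ≠ 0 := by
    by_contra! h
    exact hne (by ext p q; exact h p q)
  have hxc : (((x.val : ℕ) : ℤ) : ZMod r) = x := by simp
  rw [← hxc] at hne
  have h1 := (eq_seg_of_apply_ne_zero hf _ _ u q hne).1
  generalize ((x.val : ℕ) : ℤ) = i at h1
  set s := b.length with hs
  have hlen : ∀ n, (b ^ n).length = n * s := by
    intro n
    induction n with
    | zero => simp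
    | succ n ih => rw [pow_succ, FreeMonoid.length_mul, ih]; ring
  rw [hlen] at h1
  have hspos : 0 < s := by
    rw [Nat.pos_iff_ne_zero]; simpa [hs] using hb.1
  have hrpos : 0 < r := Nat.pos_of_ne_zero (NeZero.ne r)
  have hcat : ∀ {u v u' v' : Word d}, u.length = u'.length → u * v = u' * v' →
      u = u' ∧ v = v' := by
    intro u v u' v' hl h
    exact List.append_inj h hl
  have h2 : seg f i (r * s) = b ^ r ∧ seg f (i + (r * s : ℕ)) s = b := by
    refine hcat (by rw [length_seg, hlen]) ?_
    rw [← seg_add, ← pow_succ, h1]; congr 1; ring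
  have h3 : seg f i s = b ∧ seg f (i + s) (r * s) = b ^ r := by
    refine hcat (by rw [length_seg]) ?_
    rw [← seg_add, ← pow_succ', h1]; congr 1; ring
  have h4 : seg f (i + s) (r * s) = seg f i (r * s) := h3.2.trans h2.1.symm
  have hfrs : Function.Periodic f ((r * s : ℕ) : ℤ) := by
    have := hf.int_mul s
    simpa [mul_comm] using this
  have hper : Function.Periodic f s := by
    rw [seg_congr] at h4
    intro k
    have hr' : (0 : ℤ) < (r * s : ℕ) := by exact_mod_cast Nat.mul_pos hrpos hspos
    obtain ⟨j, hj⟩ : ∃ j : ℕ, (k - i) % (r * s : ℕ) = j :=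
      Int.eq_ofNat_of_zero_le (Int.emod_nonneg _ hr'.ne')
    have hjr : j < r * s := by
      have := Int.emod_lt_of_pos (k - i) hr'; rw [hj] at this; exact_mod_cast this
    have h5 := h4 j hjr
    have hk : k = i + j + ((k - i) / (r * s : ℕ) : ℤ) * (r * s : ℕ) := by
      have := Int.emod_add_mul_ediv (k - i) (r * s : ℕ)
      rw [hj] at this
      linarith
    have h6 := hfrs.int_mul ((k - i) / (r * s : ℕ))
    simp only [Int.cast_id] at h6
    rw [hk, add_right_comm, h6, h6, add_right_comm, h5]
  subst hr
  have hd1 : a.length ∣ s := ha.dvd_of_periodic hfa hf hper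
  have hd2 : s ∣ a.length := hb.dvd_of_periodic h3.1 hper hf
  have he := Nat.dvd_antisymm hd1 hd2
  rw [← h3.1, ← hfa, ← he]
  exact cycEquiv_seg hrpos hf i

end Cycle

lemma lift_reindex {d : ℕ} {ι κ K : Type*} [Fintype ι] [DecidableEq ι] [Fintype κ]
    [DecidableEq κ] [CommRing K] (e : ι ≃ κ) (B : Letter d → Matrix ι ι K) (a : Word d) :
    FreeMonoid.lift (fun l => Matrix.reindexAlgEquiv K K e (B l)) a =
      Matrix.reindexAlgEquiv K K e (FreeMonoid.lift B a) := by
  induction a using FreeMonoid.inductionOn' with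
  | one => simp only [map_one]
  | of_mul l a ih => rw [map_mul, map_mul, map_mul, ih]; rfl

/-- For a primitive word `a` there are matrices for which `det (1 + λ b)` takes a prescribed value
at all words cyclically equivalent to `a`, and is `1` at all other primitive words. -/
lemma exists_cycle_block {d : ℕ} {K : Type*} [Field K] {a : Word d} (ha : IsPrimitiveWord a)
    (P : K[X]) (hP : P.coeff 0 = 1) :
    ∃ (n : ℕ) (B : Letter d → Matrix (Fin n) (Fin n) K),
      (∀ b, CycEquiv b a → detPoly (FreeMonoid.lift B b) = P) ∧
      ∀ b, IsPrimitiveWord b → ¬ CycEquiv b a → detPoly (FreeMonoid.lift B b) = 1 := by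
  obtain ⟨T, Z, rfl⟩ := exists_detPoly_eq P hP
  obtain ⟨f, hf, hfa⟩ := exists_periodic ha.1
  have : NeZero a.length := ⟨by simpa using ha.1⟩
  let e : ZMod a.length × Fin T ≃ Fin _ := Fintype.equivFin _
  refine ⟨_, fun l => Matrix.reindexAlgEquiv K K e (cycleMatrix f Z l), fun b hb => ?_,
    fun b hb hab => ?_⟩
  · rw [detPoly_lift_congr _ hb, lift_reindex, detPoly_reindex, detPoly_cycleMatrix_self ha rfl hf hfa]
  · rw [lift_reindex, detPoly_reindex]
    exact detPoly_of_isNilpotent (isNilpotent_cycleMatrix ha hb rfl hf hfa hab)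

/-! ### Prescribing characteristic polynomials at finitely many primitive words -/

lemma lift_conj {d : ℕ} {ι κ K : Type*} [Fintype ι] [DecidableEq ι] [Fintype κ] [DecidableEq κ]
    [CommRing K] (B : Letter d → Matrix ι ι K) {Q : Matrix κ ι K} {Q' : Matrix ι κ K}
    (h : Q * Q' = 1) (h' : Q' * Q = 1) (a : Word d) :
    FreeMonoid.lift (fun l => Q * B l * Q') a = Q * FreeMonoid.lift B a * Q' := by
  induction a using FreeMonoid.inductionOn' with
  | one => rw [map_one, map_one, Matrix.mul_one, h]
  | of_mul l a ih =>
    rw [map_mul, map_mul, ih, FreeMonoid.lift_eval_of, FreeMonoid.lift_eval_of]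
    simp only [Matrix.mul_assoc]
    rw [← Matrix.mul_assoc Q' Q, h', Matrix.one_mul]

lemma lift_fromBlocks {d : ℕ} {ι κ K : Type*} [Fintype ι] [DecidableEq ι] [Fintype κ]
    [DecidableEq κ] [CommRing K] (B : Letter d → Matrix ι ι K) (C : Letter d → Matrix κ κ K)
    (a : Word d) :
    FreeMonoid.lift (fun l => Matrix.fromBlocks (B l) 0 0 (C l)) a =
      Matrix.fromBlocks (FreeMonoid.lift B a) 0 0 (FreeMonoid.lift C a) := by
  induction a using FreeMonoid.inductionOn' with
  | one => simp only [map_one, Matrix.fromBlocks_one]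
  | of_mul l a ih =>
    rw [map_mul, map_mul, map_mul, ih, FreeMonoid.lift_eval_of, FreeMonoid.lift_eval_of,
      FreeMonoid.lift_eval_of, Matrix.fromBlocks_multiply]
    simp

lemma lift_zero {d : ℕ} {ι K : Type*} [Fintype ι] [DecidableEq ι] [CommRing K] {a : Word d}
    (ha : a ≠ 1) : FreeMonoid.lift (fun _ : Letter d => (0 : Matrix ι ι K)) a = 0 := by
  induction a using FreeMonoid.inductionOn' with
  | one => exact absurd rfl ha
  | of_mul l a ih => rw [map_mul, FreeMonoid.lift_eval_of, Matrix.zero_mul]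

section Blocks

open scoped Classical in
-- The matrices are direct sums of cycle blocks, one for each class in `S`. A block detects
-- rotations of its representative, not of the transpose, so the condition is `CycEquiv` and not
-- `WordEquiv`.
lemma exists_detPoly_eq_prod {d : ℕ} {K : Type*} [Field K] (P : PrimClass d → K[X])
    (hP : ∀ q, (P q).coeff 0 = 1) (S : Finset (PrimClass d)) :
    ∃ (m : ℕ) (B : Letter d → Matrix (Fin m) (Fin m) K), 0 < m ∧
      ∀ b, IsPrimitiveWord b →
        detPoly (FreeMonoid.lift B b) = ∏ q ∈ S, if CycEquiv b q.out.1 then P q else 1 := by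
  induction S using Finset.induction_on with
  | empty =>
    -- A `1 × 1` zero block keeps the size positive, since `K_∞` involves only `K_n` with `n > 0`.
    refine ⟨1, fun _ => 0, one_pos, fun b hb => ?_⟩
    rw [lift_zero hb.1, detPoly_zero, Finset.prod_empty]
  | insert q S hq ih =>
    obtain ⟨m, B, hm, hB⟩ := ih
    obtain ⟨n, C, hC, hC'⟩ := exists_cycle_block q.out.2 (P q) (hP q)
    refine ⟨n + m, fun l => Matrix.reindexAlgEquiv K K finSumFinEquiv
      (Matrix.fromBlocks (C l) 0 0 (B l)), by omega, fun b hb => ?_⟩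
    rw [lift_reindex, detPoly_reindex, lift_fromBlocks, detPoly_fromBlocks, hB b hb,
      Finset.prod_insert hq]
    congr 1
    split_ifs with h
    · exact hC b h
    · exact hC' b hb h

/-- The values `det (1 + λ a) det (1 + λ aᵀ)` have, for a suitable tuple of matrices indexed by
the letters, prescribed coefficients at finitely many classes of primitive words. -/
lemma exists_coeff_detPoly_mul_eq {d : ℕ} {K : Type*} [Field K] (h2 : (2 : K) ≠ 0)
    (s : ℕ+ × PrimClass d → K) (V : Finset (ℕ+ × PrimClass d)) :
    ∃ (m : ℕ) (B : Letter d → Matrix (Fin m) (Fin m) K), 0 < m ∧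
      ∀ v ∈ V, (detPoly (FreeMonoid.lift B v.2.out.1) *
        detPoly (FreeMonoid.lift B v.2.out.1.tr)).coeff v.1 = s v := by
  classical
  set T := V.sup fun v => (v.1 : ℕ) with hT
  -- The block of `q` contributes `P` at the representative, and once more at its transpose exactly
  -- when the two are rotations of each other, as for `x xᵀ`.
  have hex : ∀ q : PrimClass d, ∃ P : K[X], P.coeff 0 = 1 ∧ ∀ t : ℕ+, (t : ℕ) ≤ T →
      (P * if CycEquiv q.out.1.tr q.out.1 then P else 1).coeff t = s (t, q) := by
    intro q
    let s' : ℕ → K := fun t => if h : 0 < t then s (⟨t, h⟩, q) else 0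
    have hs' : ∀ t : ℕ+, s' t = s (t, q) := fun t => dif_pos t.pos
    split_ifs with h
    · obtain ⟨P, hP, hP'⟩ := exists_sq_coeff_eq h2 s' T
      exact ⟨P, hP, fun t ht => (hP' t t.pos ht).trans (hs' t)⟩
    · obtain ⟨P, hP, hP'⟩ := exists_coeff_eq s' T
      exact ⟨P, hP, fun t ht => by rw [mul_one, hP' t t.pos ht, hs' t]⟩
  choose P hP hP' using hex
  obtain ⟨m, B, hm, hB⟩ := exists_detPoly_eq_prod P hP (V.image Prod.snd)
  refine ⟨m, B, hm, fun v hv => ?_⟩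
  have hmem : v.2 ∈ V.image Prod.snd := Finset.mem_image_of_mem _ hv
  have hdiff : ∀ q : PrimClass d, WordEquiv v.2.out.1 q.out.1 → q = v.2 := by
    intro q h
    rw [← Quotient.out_eq q, ← Quotient.out_eq v.2]
    exact (Quotient.sound (s := primSetoid d) h).symm
  rw [hB _ v.2.out.2, hB _ v.2.out.2.tr, Finset.prod_eq_single v.2, Finset.prod_eq_single v.2,
    if_pos (show CycEquiv v.2.out.1 v.2.out.1 from List.IsRotated.refl _)]
  · exact hP' v.2 v.1 (Finset.le_sup (f := fun v : ℕ+ × PrimClass d => (v.1 : ℕ)) hv)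
  · intro q _ hq
    refine if_neg fun h => hq (hdiff q (Or.inr ?_))
    have := h.tr
    rwa [Word.tr_tr] at this
  · exact fun h => absurd hmem h
  · exact fun q _ hq => if_neg fun h => hq (hdiff q (Or.inl h))
  · exact fun h => absurd hmem h

end Blocks

/-! ### Hyperbolic tuples of matrices -/

section Hyperbolic

variable {d : ℕ} {ι K : Type*} [Fintype ι] [DecidableEq ι] [Field K]

/-- The pair of blocks `B b`, `(B bᵀ)ᵀ`. -/
def hyperbolic (B : Letter d → Matrix ι ι K) (b : Letter d) : Matrix (ι ⊕ ι) (ι ⊕ ι) K :=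
  Matrix.fromBlocks (B b) 0 0 (B b.tr).transpose

lemma lift_transpose_tr (B : Letter d → Matrix ι ι K) (a : Word d) :
    FreeMonoid.lift (fun l => (B (Letter.tr l)).transpose) a =
      (FreeMonoid.lift B a.tr).transpose := by
  induction a using FreeMonoid.inductionOn' with
  | one => simp [Word.tr_one]
  | of_mul l a ih =>
    rw [map_mul, ih, Word.tr_mul, map_mul, Matrix.transpose_mul, FreeMonoid.lift_eval_of]
    congr 2

lemma detPoly_lift_hyperbolic (B : Letter d → Matrix ι ι K) (a : Word d) :
    detPoly (FreeMonoid.lift (hyperbolic B) a) =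
      detPoly (FreeMonoid.lift B a) * detPoly (FreeMonoid.lift B a.tr) := by
  have : hyperbolic B = fun l => Matrix.fromBlocks (B l) 0 0 (B (Letter.tr l)).transpose := rfl
  rw [this, lift_fromBlocks B (fun l => (B (Letter.tr l)).transpose), lift_transpose_tr,
    detPoly_fromBlocks, detPoly_transpose]

lemma wordEval_eq_lift {A κ : Type*} [CommRing A] [Fintype κ] [DecidableEq κ]
    (δ : Matrix κ κ A → Matrix κ κ A) (Y : Letter d → Matrix κ κ A)
    (h : ∀ k, δ (Y (k, false)) = Y (k, true)) :
    wordEval δ (fun k => Y (k, false)) = FreeMonoid.lift Y := by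
  unfold wordEval
  congr 1
  funext ⟨k, b⟩
  cases b <;> simp [h]

/-- The symplectic transpose takes `diag(M, N)` to `diag(Nᵀ, Mᵀ)`. -/
lemma sympTranspose_hyperbolic {m : ℕ} (B : Letter d → Matrix (Fin m) (Fin m) K) (k : Fin d) :
    sympTranspose (hyperbolic B (k, false)) = hyperbolic B (k, true) := by
  simp [sympTranspose, hyperbolic, Matrix.J, Matrix.fromBlocks_transpose,
    Matrix.fromBlocks_multiply, Matrix.fromBlocks_neg, Letter.tr]

/-- A change of basis from the hyperbolic quadratic form to the sum of squares. -/
def hyperbolicBasis (ι : Type*) [DecidableEq ι] {K : Type*} [Field K] (i : K) :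
    Matrix (ι ⊕ ι) (ι ⊕ ι) K :=
  Matrix.fromBlocks 1 ((2⁻¹ : K) • 1) (i • 1) (-(i * 2⁻¹) • 1)

/-- The inverse of `hyperbolicBasis`. -/
def hyperbolicBasisInv (ι : Type*) [DecidableEq ι] {K : Type*} [Field K] (i : K) :
    Matrix (ι ⊕ ι) (ι ⊕ ι) K :=
  Matrix.fromBlocks ((2⁻¹ : K) • 1) (-(i * 2⁻¹) • 1) 1 (i • 1)

lemma hyperbolicBasisInv_mul {i : K} (hi : i * i = -1) (h2 : (2 : K) ≠ 0) :
    hyperbolicBasisInv ι i * hyperbolicBasis ι i = 1 := by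
  rw [hyperbolicBasis, hyperbolicBasisInv, Matrix.fromBlocks_multiply, ← Matrix.fromBlocks_one]
  have e1 : (2 : K)⁻¹ + 2⁻¹ = 1 := by field_simp; norm_num
  congr 1 <;> simp only [Matrix.smul_mul, Matrix.one_mul, smul_smul, ← add_smul]
  · rw [show 2⁻¹ + -(i * 2⁻¹) * i = (1 : K) by linear_combination e1 - 2⁻¹ * hi, one_smul]
  · rw [show (2⁻¹ * 2⁻¹ + -(i * 2⁻¹) * -(i * 2⁻¹) : K) = 0 by
      linear_combination 2⁻¹ * 2⁻¹ * hi, zero_smul]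
  · rw [hi, neg_one_smul, add_neg_cancel]
  · rw [show (2⁻¹ : K) + i * -(i * 2⁻¹) = 1 by linear_combination e1 - 2⁻¹ * hi, one_smul]

/-- Write `Q` and `Q'` for the two basis matrices and `H` for the swap of the two blocks. Then `Q' =
H Qᵀ` for every `i`, so transposing `Q D Q'` gives `Q (H Dᵀ H) Q'`. -/
lemma transpose_hyperbolicBasis_conj (i : K) (M N : Matrix ι ι K) :
    (hyperbolicBasis ι i * Matrix.fromBlocks M 0 0 N * hyperbolicBasisInv ι i).transpose =
      hyperbolicBasis ι i * Matrix.fromBlocks N.transpose 0 0 M.transpose *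
        hyperbolicBasisInv ι i := by
  simp only [hyperbolicBasis, hyperbolicBasisInv, Matrix.fromBlocks_multiply,
    Matrix.fromBlocks_transpose]
  congr 1 <;> simp <;> module

end Hyperbolic

/-! ### Specialization of the generic matrices -/

section Specialization

variable {F : Type*} [Field F] {d : ℕ} {K : Type*} [Field K] [Algebra F K] {ι : Type*}

/-- The specialization of the generic matrices at a tuple of matrices. -/
def specialize (F : Type*) [Field F] {d : ℕ} {K : Type*} [Field K] [Algebra F K] {ι : Type*}
    (X : Fin d → Matrix ι ι K) : CoordRing F d ι →ₐ[F] K :=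
  MvPolynomial.aeval fun v => X v.2.2 v.1 v.2.1

variable [Fintype ι] [DecidableEq ι]

lemma specialize_sigma_wordEval {δ : Matrix ι ι (CoordRing F d ι) → Matrix ι ι (CoordRing F d ι)}
    {δ' : Matrix ι ι K → Matrix ι ι K} (X : Fin d → Matrix ι ι K)
    (h : ∀ Y, (δ Y).map (specialize F X) = δ' (Y.map (specialize F X))) (t : ℕ) (a : Word d) :
    specialize F X (sigma t (wordEval δ (genericMatrix F d) a)) = sigma t (wordEval δ' X a) := by
  have hX : ∀ k, (genericMatrix F d k).map (specialize F X) = X k := by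
    intro k
    ext i j
    simp [genericMatrix, specialize]
  have hw : (wordEval δ (genericMatrix F d) a).map (specialize F X) = wordEval δ' X a := by
    induction a using FreeMonoid.inductionOn' with
    | one => rw [map_one, map_one, Matrix.map_one _ (map_zero _) (map_one _)]
    | of_mul b a ih =>
      rw [map_mul, map_mul, Matrix.map_mul, ih]
      congr 1
      rcases b with ⟨k, _ | _⟩ <;> simp [wordEval, h, hX]
  rw [← hw]
  exact sigma_map (specialize F X : CoordRing F d ι →+* K) t _

/-- Specializing after `Ψ_n` is an algebra homomorphism, so it is determined by its values on the
symbols. The extension field `K` is allowed because the hyperbolic basis may need a square root of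
`-1` outside `F`. -/
lemma aeval_eq_zero_of_psiO_eq_zero {n : ℕ} {f : NSigma F d} (hf : psiO F d n f = 0)
    (X : Fin d → Matrix (Fin n) (Fin n) K) :
    MvPolynomial.aeval (fun v : ℕ+ × PrimClass d =>
      (detPoly (wordEval Matrix.transpose X v.2.out.1)).coeff v.1) f = 0 := by
  have : ((specialize F X).comp (invariantsO F d n).val).comp (psiO F d n) =
      MvPolynomial.aeval (fun v : ℕ+ × PrimClass d =>
        (detPoly (wordEval Matrix.transpose X v.2.out.1)).coeff v.1) := by
    apply MvPolynomial.algHom_ext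
    rintro ⟨t, q⟩
    rw [MvPolynomial.aeval_X, ← sigma_eq_coeff_detPoly, Fintype.card_fin,
      ← specialize_sigma_wordEval (F := F) (δ := Matrix.transpose) (δ' := Matrix.transpose) X
        (fun Y => Matrix.transpose_map.symm)]
    simp only [AlgHom.comp_apply, psiO, MvPolynomial.aeval_X]
    split_ifs
    · conv_lhs => rw [← Quotient.out_eq q]
      rfl
    · simp
  rw [← this, AlgHom.comp_apply, hf, map_zero]

lemma aeval_eq_zero_of_psiSp_eq_zero {m : ℕ} {f : NSigma F d} (hf : psiSp F d m f = 0)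
    (X : Fin d → Matrix (Fin m ⊕ Fin m) (Fin m ⊕ Fin m) K) :
    MvPolynomial.aeval (fun v : ℕ+ × PrimClass d =>
      (detPoly (wordEval sympTranspose X v.2.out.1)).coeff v.1) f = 0 := by
  have : ((specialize F X).comp (invariantsSp F d m).val).comp (psiSp F d m) =
      MvPolynomial.aeval (fun v : ℕ+ × PrimClass d =>
        (detPoly (wordEval sympTranspose X v.2.out.1)).coeff v.1) := by
    apply MvPolynomial.algHom_ext
    rintro ⟨t, q⟩
    rw [MvPolynomial.aeval_X, ← sigma_eq_coeff_detPoly, Fintype.card_sum, Fintype.card_fin,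
      ← two_mul, ← specialize_sigma_wordEval (F := F) (δ := sympTranspose) (δ' := sympTranspose) X
        (fun Y => sympTranspose_map (specialize F X).toRingHom Y)]
    simp only [AlgHom.comp_apply, psiSp, MvPolynomial.aeval_X]
    split_ifs
    · conv_lhs => rw [← Quotient.out_eq q]
      rfl
    · simp
  rw [← this, AlgHom.comp_apply, hf, map_zero]

end Specialization

/-- Over an algebraically closed field the orthogonal group contains a hyperbolic copy of the
general linear group. -/
lemma exists_detPoly_wordEval_transpose {K : Type*} [Field K] [IsAlgClosed K] (h2 : (2 : K) ≠ 0)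
    {d m : ℕ} (B : Letter d → Matrix (Fin m) (Fin m) K) :
    ∃ X : Fin d → Matrix (Fin (m + m)) (Fin (m + m)) K, ∀ a : Word d,
      detPoly (wordEval Matrix.transpose X a) =
        detPoly (FreeMonoid.lift B a) * detPoly (FreeMonoid.lift B a.tr) := by
  obtain ⟨i, hi⟩ := IsAlgClosed.exists_eq_mul_self (-1 : K)
  have hQ := hyperbolicBasisInv_mul (ι := Fin m) hi.symm h2
  have hQ' := mul_eq_one_comm.1 hQ
  let Y : Letter d → Matrix (Fin m ⊕ Fin m) (Fin m ⊕ Fin m) K := fun b =>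
    hyperbolicBasis (Fin m) i * hyperbolic B b * hyperbolicBasisInv (Fin m) i
  let e : Fin m ⊕ Fin m ≃ Fin (m + m) := finSumFinEquiv
  refine ⟨fun k => Matrix.reindexAlgEquiv K K e (Y (k, false)), fun a => ?_⟩
  have hδ : ∀ k, (Matrix.reindexAlgEquiv K K e (Y (k, false))).transpose =
      Matrix.reindexAlgEquiv K K e (Y (k, true)) := by
    intro k
    have : (Y (k, false)).transpose = Y (k, true) := by
      simp only [Y, hyperbolic]
      rw [transpose_hyperbolicBasis_conj, Matrix.transpose_transpose]
      rfl
    rw [← this]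
    rfl
  rw [wordEval_eq_lift Matrix.transpose (fun b => Matrix.reindexAlgEquiv K K e (Y b)) hδ,
    lift_reindex, detPoly_reindex, lift_conj _ hQ' hQ, Matrix.mul_assoc, detPoly_mul_comm,
    Matrix.mul_assoc, hQ, Matrix.mul_one, detPoly_lift_hyperbolic]

/-- A nonzero polynomial in the symbols `σ_t(a)` does not vanish at some values of the form
`det (1 + λ a) det (1 + λ aᵀ)`. -/
lemma exists_aeval_ne_zero {F : Type*} [Field F] {d : ℕ} {K : Type*} [Field K] [Infinite K]
    [Algebra F K] (h2 : (2 : K) ≠ 0) {f : NSigma F d} (hf : f ≠ 0) :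
    ∃ (m : ℕ) (B : Letter d → Matrix (Fin m) (Fin m) K), 0 < m ∧
      MvPolynomial.aeval (fun v : ℕ+ × PrimClass d => (detPoly (FreeMonoid.lift B v.2.out.1) *
        detPoly (FreeMonoid.lift B v.2.out.1.tr)).coeff v.1) f ≠ 0 := by
  obtain ⟨s, hs⟩ : ∃ s : ℕ+ × PrimClass d → K, MvPolynomial.aeval s f ≠ 0 := by
    by_contra! h
    refine hf (MvPolynomial.map_injective (algebraMap F K) (algebraMap F K).injective ?_)
    rw [map_zero]
    refine MvPolynomial.funext fun s => ?_
    rw [MvPolynomial.eval_map, map_zero]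
    exact h s
  -- The value of `f` depends only on its finitely many variables, so matching `s` there suffices.
  obtain ⟨m, B, hm, hB⟩ := exists_coeff_detPoly_mul_eq h2 s f.vars
  refine ⟨m, B, hm, fun h => hs ?_⟩
  rw [← h]
  exact MvPolynomial.eval₂Hom_congr' rfl (fun v hv _ => (hB v hv).symm) rfl

end FreeRel

end

/-! ### Vanishing of the ideals of free relations -/

theorem theorem1p1 (F : Type*) [Field F] [Infinite F] (hp : ringChar F ≠ 2) (d : ℕ) :
    FreeRel.freeRelationsO F d = ⊥ ∧ FreeRel.freeRelationsSp F d = ⊥ := by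
  have h2 : (2 : AlgebraicClosure F) ≠ 0 := by
    have := (map_ne_zero (algebraMap F (AlgebraicClosure F))).2 (Ring.two_ne_zero hp)
    rwa [map_ofNat] at this
  constructor
  · rw [eq_bot_iff]
    intro f hf
    by_contra hne
    obtain ⟨m, B, hm, hB⟩ := FreeRel.exists_aeval_ne_zero h2 hne
    obtain ⟨X, hX⟩ := FreeRel.exists_detPoly_wordEval_transpose h2 B
    simp only [FreeRel.freeRelationsO, Submodule.mem_iInf] at hf
    have h := FreeRel.aeval_eq_zero_of_psiO_eq_zero (hf (m + m) (by omega)) X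
    simp only [hX] at h
    exact hB h
  · rw [eq_bot_iff]
    intro f hf
    by_contra hne
    obtain ⟨m, B, hm, hB⟩ := FreeRel.exists_aeval_ne_zero h2 hne
    simp only [FreeRel.freeRelationsSp, Submodule.mem_iInf] at hf
    have h := FreeRel.aeval_eq_zero_of_psiSp_eq_zero (hf m hm)
      fun k => FreeRel.hyperbolic B (k, false)
    simp only [FreeRel.wordEval_eq_lift FreeRel.sympTranspose (FreeRel.hyperbolic B)
      (FreeRel.sympTranspose_hyperbolic B), FreeRel.detPoly_lift_hyperbolic] at h
    exact hB h
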